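/- Let $P,Q:\mathbb R\to[0,\infty)$ be continuous with $P(x)\to0$ and $Q(x)\to0$ as $|x|\to\infty$. Let $$H^{1/2}(\mathbb R)=\{u\in L^2(\mathbb R)\ \text{real-valued}:\ (-\Delta)^{1/4}u\in L^2(\mathbb R)\},\qquad \|u\|_{1/2}^2=\|u\|_{L^2}^2+\|(-\Delta)^{1/4}u\|_{L^2}^2,$$ where $(-\Delta)^{1/4}$ is the Fourier multiplier whose symbol is the square root of the absolute value of the angular frequency. For a weight $W\in\{P,Q\}$ and $q\in[2,\infty)$, let $L^q(\mathbb R;W)$ be the Banach space of measurable $u:\mathbb R\to\mathbb R$ with $\int_{\mathbb R}W(x)|u(x)|^q\,dx<\infty$, modulo equality almost everywhere with respect to the measure $W(x)\,dx$, with norm $\left(\int_{\mathbb R}W|u|^q\,dx\right)^{1/q}$. Then for every $q\in[2,\infty)$ and each $W\in\{P,Q\}$, every $u\in H^{1/2}(\mathbb R)$ belongs to $L^q(\mathbb R;W)$, and the natural linear map $H^{1/2}(\mathbb R)\to L^q(\mathbb R;W)$, which sends $u$ to its class, is continuous and compact (it maps bounded sets to relatively compact sets). (If $W$ vanishes on a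 set of positive measure, functions that differ only there are identified in $L^q(\mathbb R;W)$, so the map need not be injective.) -/

import Mathlib

open MeasureTheory Filter Topology FourierTransform
open scoped ENNReal

noncomputable section

/-- The real Hilbert space `L²(ℝ)` of real-valued square-integrable functions modulo equality
almost everywhere. -/
abbrev L2R : Type := Lp ℝ 2 (volume : Measure ℝ)

/-- The Fourier transform on `L²` of a real-valued function, regarded as a complex-valued one.
Mathlib's normalization is `û(ξ) = ∫ exp(-2πixξ) u(x) dx` on integrable functions. -/
def realFourier (u : L2R) : Lp ℂ 2 (volume : Measure ℝ) :=
  𝓕 (Complex.ofRealCLM.compLp u)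

/-- `HasFracLaplacian s u w` says that `(-Δ)^s u = w`, for `u` and `w` in `L²(ℝ)`. As `-Δ` has the
Fourier symbol `(2π|ξ|)^2`, the symbol of `(-Δ)^s` is `(2π|ξ|)^(2s)`. -/
def HasFracLaplacian (s : ℝ) (u w : L2R) : Prop :=
  ∀ᵐ ξ : ℝ, realFourier w ξ = (((2 * Real.pi * |ξ|) ^ (2 * s) : ℝ) : ℂ) * realFourier u ξ

theorem realFourier_add (u v : L2R) : realFourier (u + v) = realFourier u + realFourier v := by
  have h : Complex.ofRealCLM.compLp (u + v)
      = Complex.ofRealCLM.compLp u + Complex.ofRealCLM.compLp v :=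
    (Complex.ofRealCLM.compLpL 2 (volume : Measure ℝ)).map_add u v
  rw [realFourier, h, FourierTransform.fourier_add]; rfl

theorem realFourier_smul (c : ℝ) (u : L2R) : realFourier (c • u) = (c : ℂ) • realFourier u := by
  have h : Complex.ofRealCLM.compLp (c • u) = (c : ℂ) • Complex.ofRealCLM.compLp u := by
    have h1 : Complex.ofRealCLM.compLp (c • u) = c • Complex.ofRealCLM.compLp u :=
      (Complex.ofRealCLM.compLpL 2 (volume : Measure ℝ)).map_smul c u
    rw [h1]
    apply Lp.ext
    filter_upwards [Lp.coeFn_smul c (Complex.ofRealCLM.compLp u),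
      Lp.coeFn_smul (c : ℂ) (Complex.ofRealCLM.compLp u)] with x hx hx'
    rw [hx, hx']
    simp
  rw [realFourier, h, FourierTransform.fourier_smul]; rfl

theorem realFourier_injective : Function.Injective realFourier := by
  intro u v h
  have h1 : Complex.ofRealCLM.compLp u = Complex.ofRealCLM.compLp v :=
    (Lp.fourierTransformₗᵢ ℝ ℂ).injective h
  apply Lp.ext
  have h2 := Complex.ofRealCLM.coeFn_compLp u
  rw [h1] at h2
  filter_upwards [h2, Complex.ofRealCLM.coeFn_compLp v] with x hx hx'
  rw [hx] at hx'
  exact Complex.ofReal_injective hx'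

/-- The space `H^{1/2,2}(ℝ) = {u ∈ L²(ℝ) : (-Δ)^{1/4} u ∈ L²(ℝ)}`. Its element `u` is recorded as
the pair `(u, (-Δ)^{1/4} u)` in the Hilbert sum `L²(ℝ) ⊕ L²(ℝ)`, from which it inherits exactly
the inner product `⟨u, v⟩ = ∫ (-Δ)^{1/4}u (-Δ)^{1/4}v dx + ∫ u v dx` and the norm
`‖u‖² = ‖u‖²_{L²} + ‖(-Δ)^{1/4} u‖²_{L²}`. -/
def sobolevHalf : Submodule ℝ (WithLp 2 (L2R × L2R)) where
  carrier := {z | HasFracLaplacian (1 / 4) z.fst z.snd}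
  zero_mem' := by
    have h0 : realFourier 0 = 0 := by simpa using realFourier_smul 0 0
    have h1 : HasFracLaplacian (1 / 4) 0 0 := by
      filter_upwards [Lp.coeFn_zero ℂ 2 (volume : Measure ℝ)] with ξ hξ
      rw [h0, hξ]
      simp
    exact h1
  add_mem' := by
    intro a b ha hb
    have h1 : HasFracLaplacian (1 / 4) (a.fst + b.fst) (a.snd + b.snd) := by
      rw [HasFracLaplacian, realFourier_add, realFourier_add]
      filter_upwards [ha, hb, Lp.coeFn_add (realFourier a.fst) (realFourier b.fst),
        Lp.coeFn_add (realFourier a.snd) (realFourier b.snd)] with ξ h1 h2 h3 h4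
      rw [h3, h4, Pi.add_apply, Pi.add_apply, h1, h2, mul_add]
    exact h1
  smul_mem' := by
    intro c a ha
    have h1 : HasFracLaplacian (1 / 4) (c • a.fst) (c • a.snd) := by
      rw [HasFracLaplacian, realFourier_smul, realFourier_smul]
      filter_upwards [ha, Lp.coeFn_smul (c : ℂ) (realFourier a.fst),
        Lp.coeFn_smul (c : ℂ) (realFourier a.snd)] with ξ h1 h2 h3
      rw [h2, h3, Pi.smul_apply, Pi.smul_apply, h1, smul_eq_mul, smul_eq_mul]
      ring
    exact h1

/-- The underlying `L²` function of an element of `H^{1/2,2}(ℝ)`. -/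
def sobolevHalf.toL2 (u : sobolevHalf) : L2R := u.1.fst

/-- An element of `H^{1/2,2}(ℝ)` is determined by its underlying `L²` function. -/
theorem sobolevHalf.toL2_injective : Function.Injective sobolevHalf.toL2 := by
  rintro ⟨a, ha⟩ ⟨b, hb⟩ h
  have h1 : a.fst = b.fst := h
  have h2 : a.snd = b.snd := by
    apply realFourier_injective
    apply Lp.ext
    have ha' : HasFracLaplacian (1 / 4) a.fst a.snd := ha
    have hb' : HasFracLaplacian (1 / 4) b.fst b.snd := hb
    rw [h1] at ha'
    filter_upwards [ha', hb'] with ξ hx hx'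
    rw [hx, hx']
  apply Subtype.ext
  exact (WithLp.equiv 2 (L2R × L2R)).injective (Prod.ext h1 h2)

/-- The norm of `H^{1/2,2}(ℝ)`. -/
theorem sobolevHalf.norm_sq_eq (u : sobolevHalf) :
    ‖u‖ ^ 2 = ‖sobolevHalf.toL2 u‖ ^ 2 + ‖u.1.snd‖ ^ 2 :=
  WithLp.prod_norm_sq_eq_of_L2 u.1

/-- The measure `P(x) dx`. -/
def weightedMeasure (P : ℝ → ℝ) : Measure ℝ :=
  volume.withDensity fun x => ENNReal.ofReal (P x)

/-- The weighted space `L^q(ℝ; P)` of real-valued measurable `u` with `∫ P(x) |u(x)|^q dx < ∞`,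
modulo equality almost everywhere for `P(x) dx`, with the norm `(∫ P(x) |u(x)|^q dx)^(1/q)`. -/
abbrev WeightedLp (q : ℝ≥0∞) (P : ℝ → ℝ) : Type := Lp ℝ q (weightedMeasure P)

/-- `H^{1/2,2}(ℝ)` is compactly embedded in `L^q(ℝ; P)`: every element of `H^{1/2,2}(ℝ)` belongs to
`L^q(ℝ; P)`, and the natural map taking `u` to its class in `L^q(ℝ; P)` is a continuous linear
operator that is compact. -/
def CompactlyEmbedded (q : ℝ≥0∞) [Fact (1 ≤ q)] (P : ℝ → ℝ) : Prop :=
  ∃ T : sobolevHalf →L[ℝ] WeightedLp q P,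
    (∀ u : sobolevHalf, ⇑(T u) =ᵐ[weightedMeasure P] ⇑(sobolevHalf.toL2 u)) ∧ IsCompactOperator T

end

open MeasureTheory Filter Topology FourierTransform
open scoped ENNReal

/-! The embedding is a limit, in operator norm, of finite-rank operators. Having half a derivative
in `L²` makes the Fourier transform of `u` on `|ξ| ≥ R` at most `R^(-1/2) ‖u‖` in `L²`. By
Bernstein's inequality the part of `u` with `R ≤ |ξ| < 2R` has `L^q` norm at most `2 R^(-1/q) ‖u‖`.
Since `q` is finite, these bounds form a geometric series over dyadic `R`, so truncating to
frequencies below `2^n` approximates `u` in `L^q`, uniformly on bounded sets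
(`eLpNorm_sub_lowPass_pow_le`). The weight is bounded, so this survives in the weighted space.

The truncation is Lipschitz with constant controlled by `n` and `‖u‖`. On a bounded window it is
therefore close to the step function of its values on a fine grid, which depends on finitely many
continuous functionals of `u`. Outside a large window the decay of the weight makes it negligible.
`eLpNorm_toL2_sub_sampling_le` adds up the three errors. -/

/-! ### Inverse Fourier integrals and `L^q` interpolation -/

/-- Fubini, with a kernel symmetric in its two variables. -/
theorem integral_fourierInv_smul_eq_of_integrable {f g : ℝ → ℂ} (hf : Integrable f)
    (hg : Integrable g) : ∫ x, 𝓕⁻ f x • g x = ∫ x, f x • 𝓕⁻ g x := by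
  have h := VectorFourier.integral_fourierIntegral_smul_eq_flip (μ := volume) (ν := volume)
    (L := -innerₗ ℝ) (e := 𝐞) Real.continuous_fourierChar (by
      simp only [LinearMap.neg_apply, innerₗ_apply_apply]; fun_prop) hf hg
  have hL : (-innerₗ ℝ).flip = -innerₗ ℝ := by
    ext; simp
  rw [hL] at h
  exact h

/-- The `L²` inverse Fourier transform of an integrable function is given by the integral. -/
theorem Lp_fourierInv_coeFn_ae_eq (g : Lp ℂ 2 (volume : Measure ℝ)) (hg : Integrable g) :
    ⇑(𝓕⁻ g : Lp ℂ 2 (volume : Measure ℝ)) =ᵐ[volume] 𝓕⁻ (g : ℝ → ℂ) := by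
  have hcont : Continuous (𝓕⁻ (g : ℝ → ℂ)) :=
    VectorFourier.fourierIntegral_continuous Real.continuous_fourierChar
      (by simp only [LinearMap.neg_apply, innerₗ_apply_apply]; fun_prop) hg
  refine ae_eq_of_integral_contDiff_smul_eq
    ((Lp.memLp (𝓕⁻ g : Lp ℂ 2 (volume : Measure ℝ))).locallyIntegrable (by norm_num))
    hcont.locallyIntegrable ?_
  intro φ hφ hφc
  have hφ' : ContDiff ℝ (⊤ : ℕ∞) (fun x => (φ x : ℂ)) := Complex.ofRealCLM.contDiff.comp hφ
  have hφc' : HasCompactSupport (fun x => (φ x : ℂ)) := hφc.comp_left Complex.ofReal_zero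
  set ψ : SchwartzMap ℝ ℂ := hφc'.toSchwartzMap hφ' with hψ
  have hψx : ∀ x, ψ x = φ x := fun x => rfl
  -- The `L²` transform agrees with the distributional one, which acts by transforming the test
  -- function; Fubini then moves the transform back onto `g`.
  have h1 := congrArg (fun D => D ψ) (Lp.fourierInv_toTemperedDistribution_eq g)
  simp only [TemperedDistribution.fourierInv_apply, Lp.toTemperedDistribution_apply] at h1
  rw [SchwartzMap.fourierInv_coe,
    integral_fourierInv_smul_eq_of_integrable ψ.integrable hg] at h1
  simpa [hψx] using h1.symm

/-- Integrate `|f|^q ≤ K^(q-2) |f|^2`. -/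
theorem eLpNorm_le_rpow_mul_eLpNorm_two_rpow {α : Type*} [MeasurableSpace α] {μ : Measure α}
    {f : α → ℝ} {K q : ℝ≥0∞} (hK : K ≠ ∞) (hq : 2 ≤ q) (hq_top : q ≠ ∞)
    (hf : ∀ x, ‖f x‖ₑ ≤ K) :
    eLpNorm f q μ ≤ K ^ (1 - 2 / q.toReal) * eLpNorm f 2 μ ^ (2 / q.toReal) := by
  have hq2 : 2 ≤ q.toReal := by simpa using ENNReal.toReal_mono hq_top hq
  have hq0 : q ≠ 0 := by rintro rfl; simp at hq
  rw [eLpNorm_eq_lintegral_rpow_enorm_toReal hq0 hq_top,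
    eLpNorm_eq_lintegral_rpow_enorm_toReal two_ne_zero (by simp), ← ENNReal.rpow_mul]
  have h1 : ∫⁻ x, ‖f x‖ₑ ^ q.toReal ∂μ
      ≤ K ^ (q.toReal - 2) * ∫⁻ x, ‖f x‖ₑ ^ (2 : ℝ≥0∞).toReal ∂μ := by
    rw [← lintegral_const_mul']
    · refine lintegral_mono fun x => ?_
      calc ‖f x‖ₑ ^ q.toReal = ‖f x‖ₑ ^ ((q.toReal - 2) + 2) := by ring_nf
        _ = ‖f x‖ₑ ^ (q.toReal - 2) * ‖f x‖ₑ ^ (2 : ℝ) :=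
          ENNReal.rpow_add_of_nonneg _ _ (by linarith) (by norm_num)
        _ ≤ K ^ (q.toReal - 2) * ‖f x‖ₑ ^ (2 : ℝ≥0∞).toReal := by
          rw [ENNReal.toReal_ofNat]
          gcongr
          exact hf x
    · exact ENNReal.rpow_ne_top_of_nonneg (by linarith) hK
  calc (∫⁻ x, ‖f x‖ₑ ^ q.toReal ∂μ) ^ (1 / q.toReal)
      ≤ (K ^ (q.toReal - 2) * ∫⁻ x, ‖f x‖ₑ ^ (2 : ℝ≥0∞).toReal ∂μ) ^ (1 / q.toReal) := by
        gcongr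
    _ = _ := by
        rw [ENNReal.mul_rpow_of_nonneg _ _ (by positivity), ← ENNReal.rpow_mul]
        congr 2
        · field_simp
        · simp; field_simp

/-! ### Band-limited functions and Bernstein's inequality -/

/-- The real part of the inverse Fourier integral of the restriction of `g` to `A`. -/
noncomputable def bandPart (A : Set ℝ) (g : ℝ → ℂ) (x : ℝ) : ℝ := (𝓕⁻ (A.indicator g) x).re

section

variable {A B : Set ℝ} {g h : ℝ → ℂ}

theorem eLpNorm_indicator_one_le (hA : MeasurableSet A) (hg : MemLp g 2) :
    eLpNorm (A.indicator g) 1 ≤ eLpNorm (A.indicator g) 2 * volume A ^ (1 / 2 : ℝ) := by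
  rw [eLpNorm_indicator_eq_eLpNorm_restrict hA, eLpNorm_indicator_eq_eLpNorm_restrict hA]
  refine (eLpNorm_le_eLpNorm_mul_rpow_measure_univ (p := 1) (q := 2) (by norm_num)
    hg.1.restrict).trans_eq ?_
  norm_num

theorem integrable_indicator_of_memLp_two (hA : MeasurableSet A) (hA' : volume A ≠ ∞)
    (hg : MemLp g 2) : Integrable (A.indicator g) := by
  rw [← memLp_one_iff_integrable]
  refine ⟨hg.1.indicator hA, (eLpNorm_indicator_one_le hA hg).trans_lt ?_⟩
  exact ENNReal.mul_lt_top (hg.indicator hA).2 (ENNReal.rpow_lt_top_of_nonneg (by norm_num) hA')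

theorem continuous_bandPart (hA : MeasurableSet A) (hA' : volume A ≠ ∞) (hg : MemLp g 2) :
    Continuous (bandPart A g) :=
  Complex.continuous_re.comp (VectorFourier.fourierIntegral_continuous
    Real.continuous_fourierChar (by simp only [LinearMap.neg_apply, innerₗ_apply_apply]; fun_prop)
    (integrable_indicator_of_memLp_two hA hA' hg))

theorem bandPart_add (hA : MeasurableSet A) (hA' : volume A ≠ ∞) (hg : MemLp g 2)
    (hh : MemLp h 2) (x : ℝ) : bandPart A (g + h) x = bandPart A g x + bandPart A h x := by
  have := VectorFourier.fourierIntegral_add (e := 𝐞) (μ := (volume : Measure ℝ)) (L := -innerₗ ℝ)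
    Real.continuous_fourierChar (by simp only [LinearMap.neg_apply, innerₗ_apply_apply]; fun_prop)
    (integrable_indicator_of_memLp_two hA hA' hg) (integrable_indicator_of_memLp_two hA hA' hh)
  rw [← Set.indicator_add'] at this
  exact congrArg Complex.re (congrFun this x)

theorem bandPart_smul (c : ℝ) (x : ℝ) :
    bandPart A ((c : ℂ) • g) x = c * bandPart A g x := by
  have := VectorFourier.fourierIntegral_const_smul 𝐞 (volume : Measure ℝ) (-innerₗ ℝ)
    (A.indicator g) (c : ℂ)
  have h2 : A.indicator ((c : ℂ) • g) = (c : ℂ) • A.indicator g := by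
    exact Set.indicator_const_smul A (c : ℂ) g
  rw [← h2] at this
  exact (congrArg Complex.re (congrFun this x)).trans (Complex.re_ofReal_mul _ _)

/-- Equality holds at every `x`, so point evaluations will be well defined and linear on `L²`
classes. -/
theorem bandPart_congr_ae (hgh : g =ᵐ[volume] h) (x : ℝ) : bandPart A g x = bandPart A h x := by
  rw [bandPart, bandPart, Real.fourierInv_eq, Real.fourierInv_eq]
  congr 1
  refine integral_congr_ae ?_
  filter_upwards [hgh] with ξ hξ
  simp only [Set.indicator, hξ]

theorem bandPart_diff (hA : MeasurableSet A) (hA' : volume A ≠ ∞) (hB : MeasurableSet B)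
    (hBA : B ⊆ A) (hg : MemLp g 2) (x : ℝ) :
    bandPart (A \ B) g x = bandPart A g x - bandPart B g x := by
  have hB' : volume B ≠ ∞ := ne_top_of_le_ne_top hA' (measure_mono hBA)
  have hAB : volume (A \ B) ≠ ∞ := ne_top_of_le_ne_top hA' (measure_mono Set.sdiff_subset)
  have := VectorFourier.fourierIntegral_add (e := 𝐞) (μ := (volume : Measure ℝ)) (L := -innerₗ ℝ)
    Real.continuous_fourierChar (by simp only [LinearMap.neg_apply, innerₗ_apply_apply]; fun_prop)
    (integrable_indicator_of_memLp_two (hA.diff hB) hAB hg)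
    (integrable_indicator_of_memLp_two hB hB' hg)
  have hAB' : (A \ B).indicator g + B.indicator g = A.indicator g := by
    ext ξ
    by_cases h1 : ξ ∈ B
    · simp [h1, hBA h1]
    · by_cases h2 : ξ ∈ A <;> simp [h1, h2]
  rw [hAB'] at this
  have h2 := congrArg Complex.re (congrFun this x)
  exact eq_sub_of_add_eq h2.symm

theorem enorm_bandPart_le (x : ℝ) : ‖bandPart A g x‖ₑ ≤ eLpNorm (A.indicator g) 1 := by
  rw [bandPart, Real.fourierInv_eq, eLpNorm_one_eq_lintegral_enorm]
  calc ‖(∫ v, 𝐞 (inner ℝ v x) • A.indicator g v).re‖ₑ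
      ≤ ‖∫ v, 𝐞 (inner ℝ v x) • A.indicator g v‖ₑ := by
        rw [enorm_le_iff_norm_le]; exact Complex.abs_re_le_norm _
    _ ≤ ∫⁻ v, ‖𝐞 (inner ℝ v x) • A.indicator g v‖ₑ := enorm_integral_le_lintegral_enorm _
    _ = _ := by
        congr 1 with v
        simp [← ofReal_norm]

theorem enorm_bandPart_le_rpow_mul (hA : MeasurableSet A) (hg : MemLp g 2) (x : ℝ) :
    ‖bandPart A g x‖ₑ ≤ eLpNorm (A.indicator g) 2 * volume A ^ (1 / 2 : ℝ) :=
  (enorm_bandPart_le x).trans (eLpNorm_indicator_one_le hA hg)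

/-- The `L²` inverse Fourier transform of the restriction of `g` to `A`. -/
noncomputable def bandLp (hA : MeasurableSet A) (hg : MemLp g 2) : Lp ℂ 2 (volume : Measure ℝ) :=
  𝓕⁻ ((hg.indicator hA).toLp _)

/-- Links the pointwise integral, which gives sup and Lipschitz bounds, with the `L²` transform,
which gives Plancherel. -/
theorem bandPart_ae_eq (hA : MeasurableSet A) (hA' : volume A ≠ ∞) (hg : MemLp g 2) :
    bandPart A g =ᵐ[volume] fun x => (bandLp hA hg x).re := by
  have hc := (hg.indicator hA).coeFn_toLp
  have h1 := Lp_fourierInv_coeFn_ae_eq ((hg.indicator hA).toLp _)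
    ((integrable_congr hc).2 (integrable_indicator_of_memLp_two hA hA' hg))
  filter_upwards [h1] with x hx
  rw [bandLp, hx, bandPart, Real.fourierInv_eq, Real.fourierInv_eq]
  congr 1
  refine integral_congr_ae ?_
  filter_upwards [hc] with ξ hξ
  rw [hξ]

theorem eLpNorm_bandPart_two_le (hA : MeasurableSet A) (hA' : volume A ≠ ∞) (hg : MemLp g 2) :
    eLpNorm (bandPart A g) 2 ≤ eLpNorm (A.indicator g) 2 := by
  have hF : ‖bandLp hA hg‖ₑ = ‖(hg.indicator hA).toLp _‖ₑ := by
    rw [← ofReal_norm, ← ofReal_norm]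
    exact congrArg _ ((Lp.fourierTransformₗᵢ ℝ ℂ).symm.norm_map _)
  rw [Lp.enorm_def, Lp.enorm_toLp] at hF
  rw [← hF]
  refine eLpNorm_mono_enorm_ae ?_
  filter_upwards [bandPart_ae_eq hA hA' hg] with x hx
  rw [hx, enorm_le_iff_norm_le]
  exact Complex.abs_re_le_norm _

/-- Bernstein's inequality. -/
theorem eLpNorm_bandPart_le {q : ℝ≥0∞} (hq : 2 ≤ q) (hq_top : q ≠ ∞) (hA : MeasurableSet A)
    (hA' : volume A ≠ ∞) (hg : MemLp g 2) :
    eLpNorm (bandPart A g) q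
      ≤ eLpNorm (A.indicator g) 2 * volume A ^ (1 / 2 - 1 / q.toReal : ℝ) := by
  have hq2 : 2 ≤ q.toReal := by simpa using ENNReal.toReal_mono hq_top hq
  have h1 : 0 ≤ 1 - 2 / q.toReal := by rw [sub_nonneg, div_le_one] <;> linarith
  -- Interpolation between the sup bound from Cauchy–Schwarz on `A` and the `L²` bound from
  -- Plancherel.
  refine (eLpNorm_le_rpow_mul_eLpNorm_two_rpow (ENNReal.mul_ne_top (hg.indicator hA).2.ne
    (ENNReal.rpow_ne_top_of_nonneg (by norm_num) hA')) hq hq_top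
    (enorm_bandPart_le_rpow_mul hA hg)).trans ?_
  calc _ ≤ (eLpNorm (A.indicator g) 2 * volume A ^ (1 / 2 : ℝ)) ^ (1 - 2 / q.toReal)
        * eLpNorm (A.indicator g) 2 ^ (2 / q.toReal) := by
        gcongr; exact eLpNorm_bandPart_two_le hA hA' hg
    _ = eLpNorm (A.indicator g) 2 ^ ((1 - 2 / q.toReal) + 2 / q.toReal)
        * volume A ^ (1 / 2 * (1 - 2 / q.toReal)) := by
        rw [ENNReal.rpow_add_of_nonneg _ _ h1 (by positivity), ENNReal.mul_rpow_of_nonneg _ _ h1,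
          ← ENNReal.rpow_mul]
        ring
    _ = _ := by
        rw [sub_add_cancel, ENNReal.rpow_one]
        congr 2
        ring

/-- Follows from `|exp(iθ) - 1| ≤ |θ|` with `θ = 2πv(x - y)` and `|v| ≤ R`. -/
theorem enorm_bandPart_sub_le {R : ℝ} (hA : MeasurableSet A) (hAR : ∀ ξ ∈ A, |ξ| ≤ R)
    (hA' : volume A ≠ ∞) (hg : MemLp g 2) (x y : ℝ) :
    ‖bandPart A g x - bandPart A g y‖ₑ
      ≤ ENNReal.ofReal (2 * Real.pi * R * |x - y|) * eLpNorm (A.indicator g) 1 := by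
  have hi := integrable_indicator_of_memLp_two hA hA' hg
  have hI : ∀ x : ℝ, Integrable fun v : ℝ => 𝐞 (inner ℝ v x) • A.indicator g v := fun x => by
    refine hi.mono ?_ (by simp)
    exact (Continuous.aestronglyMeasurable (by fun_prop)).smul hi.1
  rw [bandPart, bandPart, Real.fourierInv_eq, Real.fourierInv_eq, ← Complex.sub_re,
    ← integral_sub (hI x) (hI y), eLpNorm_one_eq_lintegral_enorm,
    ← lintegral_const_mul' _ _ (by simp)]
  refine (show _ ≤ ‖∫ v, (𝐞 (inner ℝ v x) • A.indicator g v - 𝐞 (inner ℝ v y) • A.indicator g v)‖ₑ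
    by rw [enorm_le_iff_norm_le]; exact Complex.abs_re_le_norm _).trans ?_
  refine (enorm_integral_le_lintegral_enorm _).trans (lintegral_mono fun v => ?_)
  by_cases hv : v ∈ A
  · rw [Circle.smul_def, Circle.smul_def, ← sub_smul, enorm_smul]
    gcongr
    rw [← ofReal_norm]
    gcongr
    have : ((𝐞 (inner ℝ v x) : Circle) : ℂ) - 𝐞 (inner ℝ v y)
        = 𝐞 (inner ℝ v y) * (Complex.exp (Complex.I * ((2 * Real.pi * (v * (x - y)) : ℝ))) - 1) := by
      rw [Real.fourierChar_apply, Real.fourierChar_apply, mul_sub, ← Complex.exp_add, mul_one]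
      congr 2
      simp
      ring
    rw [this, norm_mul, Circle.norm_coe, one_mul]
    refine (Real.norm_exp_I_mul_ofReal_sub_one_le).trans ?_
    rw [Real.norm_eq_abs, abs_mul, abs_mul, abs_mul, abs_of_pos Real.pi_pos, abs_two, ← mul_assoc]
    gcongr
    exact hAR v hv
  · simp [hv]

end

/-! ### Dyadic frequency decomposition in `H^{1/2}` -/

namespace sobolevHalf

theorem eLpNorm_realFourier (u : L2R) : eLpNorm (realFourier u) 2 = ‖u‖ₑ := by
  rw [← Lp.enorm_def, ← ofReal_norm, realFourier, Lp.norm_fourier_eq, ofReal_norm, Lp.enorm_def,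
    Lp.enorm_def]
  refine eLpNorm_congr_norm_ae ?_
  filter_upwards [Complex.ofRealCLM.coeFn_compLp u] with x hx
  simp [hx]

theorem enorm_toL2_le (z : sobolevHalf) : ‖toL2 z‖ₑ ≤ ‖z‖ₑ := by
  rw [enorm_le_iff_norm_le]
  refine le_of_sq_le_sq ?_ (norm_nonneg _)
  rw [norm_sq_eq]
  nlinarith [sq_nonneg ‖z.1.snd‖]

theorem enorm_snd_le (z : sobolevHalf) : ‖z.1.snd‖ₑ ≤ ‖z‖ₑ := by
  rw [enorm_le_iff_norm_le]
  refine le_of_sq_le_sq ?_ (norm_nonneg _)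
  rw [norm_sq_eq]
  nlinarith [sq_nonneg ‖toL2 z‖]

/-- The Fourier transform of an element of `H^{1/2}`. -/
noncomputable def hat (z : sobolevHalf) : ℝ → ℂ := realFourier (toL2 z)

theorem memLp_hat (z : sobolevHalf) : MemLp (hat z) 2 := Lp.memLp _

theorem eLpNorm_indicator_hat_le (z : sobolevHalf) (A : Set ℝ) :
    eLpNorm (A.indicator (hat z)) 2 ≤ ‖z‖ₑ :=
  (eLpNorm_indicator_le _).trans ((eLpNorm_realFourier (toL2 z)).trans_le (enorm_toL2_le z))

/-- On `A` the symbol `(2π|ξ|)^(1/2)` is at least `R^(1/2)`; the factor `2π` is discarded. -/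
theorem eLpNorm_indicator_hat_le_of_le_abs (z : sobolevHalf) {A : Set ℝ} {R : ℝ}
    (hR : 0 < R) (hA : ∀ ξ ∈ A, R ≤ |ξ|) :
    eLpNorm (A.indicator (hat z)) 2 ≤ ENNReal.ofReal (R ^ (-(1 / 2) : ℝ)) * ‖z‖ₑ := by
  refine le_trans ?_ (mul_le_mul_right (enorm_snd_le z) _)
  rw [← eLpNorm_realFourier]
  refine eLpNorm_le_mul_eLpNorm_of_ae_le_mul ?_ 2
  have hz : HasFracLaplacian (1 / 4) (toL2 z) z.1.snd := z.2
  filter_upwards [hz] with ξ hξ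
  by_cases h : ξ ∈ A
  · rw [Set.indicator_of_mem h, hξ, norm_mul, Complex.norm_real, ← mul_assoc, Real.norm_eq_abs,
      abs_of_nonneg (by positivity)]
    refine le_mul_of_one_le_left (norm_nonneg _) ?_
    calc (1 : ℝ) = R ^ (-(1 / 2) : ℝ) * R ^ (1 / 2 : ℝ) := by
          rw [← Real.rpow_add hR]; simp
      _ ≤ R ^ (-(1 / 2) : ℝ) * (2 * Real.pi * |ξ|) ^ (2 * (1 / 4) : ℝ) := by
          rw [show (2 * (1 / 4) : ℝ) = 1 / 2 by norm_num]
          gcongr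
          nlinarith [hA ξ h, Real.pi_gt_three, abs_nonneg ξ]
  · rw [Set.indicator_of_notMem h, norm_zero]; positivity

theorem toL2_ae_eq (z : sobolevHalf) :
    ⇑(toL2 z) =ᵐ[volume] fun x => ((𝓕⁻ (realFourier (toL2 z)) : Lp ℂ 2 (volume : Measure ℝ)) x).re := by
  have : (𝓕⁻ (realFourier (toL2 z)) : Lp ℂ 2 (volume : Measure ℝ))
      = Complex.ofRealCLM.compLp (toL2 z) := fourierInv_fourier_eq _
  rw [this]
  filter_upwards [Complex.ofRealCLM.coeFn_compLp (toL2 z)] with x hx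
  simp [hx]

/-- Plancherel for the discarded frequencies. As `z` is real-valued, it equals the real part of its
inverse transform, and taking real parts does not increase the norm. -/
theorem eLpNorm_bandPart_sub_le (z : sobolevHalf) {A : Set ℝ} (hA : MeasurableSet A)
    (hA' : volume A ≠ ∞) :
    eLpNorm (bandPart A (hat z) - ⇑(toL2 z)) 2 ≤ eLpNorm (Aᶜ.indicator (hat z)) 2 := by
  set D : Lp ℂ 2 (volume : Measure ℝ) :=
    ((memLp_hat z).indicator hA).toLp _ - realFourier (toL2 z) with hD
  have h1 : eLpNorm (𝓕⁻ D : Lp ℂ 2 (volume : Measure ℝ)) 2 = eLpNorm D 2 := by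
    rw [← Lp.enorm_def, ← Lp.enorm_def, ← ofReal_norm, ← ofReal_norm]
    exact congrArg _ ((Lp.fourierTransformₗᵢ ℝ ℂ).symm.norm_map _)
  have h2 : eLpNorm D 2 = eLpNorm (Aᶜ.indicator (hat z)) 2 := by
    refine eLpNorm_congr_norm_ae ?_
    filter_upwards [Lp.coeFn_sub (((memLp_hat z).indicator hA).toLp _) (realFourier (toL2 z)),
      ((memLp_hat z).indicator hA).coeFn_toLp] with ξ h3 h4
    rw [h3, Pi.sub_apply, h4]
    by_cases h : ξ ∈ A <;> simp [h, hat]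
  rw [← h2, ← h1]
  have h5 : (𝓕⁻ D : Lp ℂ 2 (volume : Measure ℝ))
      = bandLp hA (memLp_hat z) - 𝓕⁻ (realFourier (toL2 z)) :=
    (Lp.fourierTransformₗᵢ ℝ ℂ).symm.map_sub _ _
  rw [h5]
  refine eLpNorm_mono_enorm_ae ?_
  filter_upwards [bandPart_ae_eq hA hA' (memLp_hat z), (toL2_ae_eq z),
    Lp.coeFn_sub (bandLp hA (memLp_hat z)) (𝓕⁻ (realFourier (toL2 z)))] with x hx hx' hx''
  rw [Pi.sub_apply, hx, hx', hx'', Pi.sub_apply, ← Complex.sub_re, enorm_le_iff_norm_le]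
  exact Complex.abs_re_le_norm _

/-- The part of `z` of frequency less than `R`. -/
noncomputable def lowPass (z : sobolevHalf) (R : ℝ) : ℝ → ℝ :=
  bandPart (Metric.ball 0 R) (hat z)

theorem continuous_lowPass (z : sobolevHalf) (R : ℝ) : Continuous (lowPass z R) :=
  continuous_bandPart measurableSet_ball (by simp [ENNReal.mul_eq_top]) (memLp_hat z)

section

variable {q : ℝ≥0∞}

/-- The shell has measure at most `4R`, so Bernstein costs `(4R)^(1/2 - 1/q)` against the gain
`R^(-1/2)`. The powers of `R` combine to `R^(-1/q)`, and `4^(1/2 - 1/q) ≤ 2`. -/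
theorem eLpNorm_lowPass_double_sub_le (z : sobolevHalf) (hq : 2 ≤ q) (hq_top : q ≠ ∞)
    {R : ℝ} (hR : 0 < R) :
    eLpNorm (lowPass z (2 * R) - lowPass z R) q
      ≤ ENNReal.ofReal (2 * R ^ (-(1 / q.toReal))) * ‖z‖ₑ := by
  have hq2 : 2 ≤ q.toReal := by simpa using ENNReal.toReal_mono hq_top hq
  have hs : 0 ≤ 1 / 2 - 1 / q.toReal := by
    rw [sub_nonneg]; exact one_div_le_one_div_of_le (by norm_num) hq2
  set A : Set ℝ := Metric.ball 0 (2 * R) \ Metric.ball 0 R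
  have hA : MeasurableSet A := measurableSet_ball.diff measurableSet_ball
  have hvol : volume A ≤ ENNReal.ofReal (4 * R) := by
    refine (measure_mono Set.sdiff_subset).trans_eq ?_
    rw [Real.volume_ball]; congr 1; ring
  have hA' : volume A ≠ ∞ := ne_top_of_le_ne_top ENNReal.ofReal_ne_top hvol
  have heq : lowPass z (2 * R) - lowPass z R = bandPart A (hat z) := by
    ext x
    exact (bandPart_diff measurableSet_ball (by simp [ENNReal.mul_eq_top]) measurableSet_ball
      (Metric.ball_subset_ball (by linarith)) (memLp_hat z) x).symm
  have hAR : ∀ ξ ∈ A, R ≤ |ξ| := fun ξ hξ => by simpa using hξ.2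
  rw [heq]
  refine (eLpNorm_bandPart_le hq hq_top hA hA' (memLp_hat z)).trans ?_
  calc _ ≤ (ENNReal.ofReal (R ^ (-(1 / 2) : ℝ)) * ‖z‖ₑ)
        * ENNReal.ofReal (4 * R) ^ (1 / 2 - 1 / q.toReal) := by
        gcongr; exact eLpNorm_indicator_hat_le_of_le_abs z hR hAR
    _ = ENNReal.ofReal (R ^ (-(1 / 2) : ℝ) * (4 * R) ^ (1 / 2 - 1 / q.toReal)) * ‖z‖ₑ := by
        rw [ENNReal.ofReal_rpow_of_nonneg (by positivity) hs,
          ENNReal.ofReal_mul (p := R ^ (-(1 / 2) : ℝ)) (by positivity)]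
        ring
    _ ≤ _ := by
        refine mul_le_mul_left (ENNReal.ofReal_le_ofReal ?_) _
        rw [Real.mul_rpow (by norm_num) hR.le, mul_left_comm, ← Real.rpow_add hR]
        have h4 : (4 : ℝ) ^ (1 / 2 - 1 / q.toReal) ≤ 2 := by
          calc (4 : ℝ) ^ (1 / 2 - 1 / q.toReal) ≤ 4 ^ (1 / 2 : ℝ) := by
                gcongr
                · norm_num
                · have : 0 ≤ 1 / q.toReal := by positivity
                  linarith
            _ = 2 := by
                rw [show (4 : ℝ) = 2 ^ (2 : ℝ) by norm_num, ← Real.rpow_mul (by norm_num)]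
                norm_num
        rw [show -(1 / 2) + (1 / 2 - 1 / q.toReal) = -(1 / q.toReal) by ring]
        gcongr

/-- Telescoping over shells: the exact partial sum of the geometric series is kept so that the
induction closes. -/
theorem eLpNorm_lowPass_pow_sub_le (z : sobolevHalf) (hq : 2 ≤ q) (hq_top : q ≠ ∞)
    {r : ℝ} (hr : r = 2 ^ (-(1 / q.toReal))) (hr1 : r < 1) {n m : ℕ} (hnm : n ≤ m) :
    eLpNorm (lowPass z (2 ^ m) - lowPass z (2 ^ n)) q
      ≤ ENNReal.ofReal (2 * (r ^ n - r ^ m) / (1 - r)) * ‖z‖ₑ := by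
  have hr0 : 0 < r := hr ▸ by positivity
  have hq1 : 1 ≤ q := le_trans (by norm_num) hq
  induction m, hnm using Nat.le_induction with
  | base => simp
  | succ m hnm ih =>
    have hstep := eLpNorm_lowPass_double_sub_le z hq hq_top (R := 2 ^ m) (by positivity)
    have hrm : ((2 : ℝ) ^ m) ^ (-(1 / q.toReal)) = r ^ m := by
      rw [hr, ← Real.rpow_natCast, ← Real.rpow_natCast, ← Real.rpow_mul (by norm_num),
        ← Real.rpow_mul (by norm_num), mul_comm]
    rw [hrm, ← pow_succ'] at hstep
    have hle : r ^ m ≤ r ^ n := pow_le_pow_of_le_one hr0.le hr1.le hnm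
    have hc := fun k : ℕ => (continuous_lowPass z (2 ^ k)).aestronglyMeasurable (μ := volume)
    have hsplit : lowPass z (2 ^ (m + 1)) - lowPass z (2 ^ n)
        = (lowPass z (2 ^ m) - lowPass z (2 ^ n))
          + (lowPass z (2 ^ (m + 1)) - lowPass z (2 ^ m)) := by abel
    rw [hsplit]
    refine (eLpNorm_add_le ((hc m).sub (hc n)) ((hc (m + 1)).sub (hc m)) hq1).trans
      ((add_le_add ih hstep).trans_eq ?_)
    rw [← add_mul, ← ENNReal.ofReal_add (by
      have : 0 < 1 - r := by linarith
      have : 0 ≤ r ^ n - r ^ m := by linarith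
      positivity) (by positivity)]
    congr 2
    have : 1 - r ≠ 0 := by linarith
    field_simp
    ring

theorem tendsto_eLpNorm_lowPass_sub (z : sobolevHalf) :
    Tendsto (fun n : ℕ => eLpNorm (lowPass z (2 ^ n) - ⇑(toL2 z)) 2) atTop (𝓝 0) := by
  have h1 : ∀ n : ℕ, eLpNorm (lowPass z (2 ^ n) - ⇑(toL2 z)) 2
      ≤ ENNReal.ofReal (((2 : ℝ) ^ n) ^ (-(1 / 2) : ℝ)) * ‖z‖ₑ := fun n =>
    (eLpNorm_bandPart_sub_le z measurableSet_ball (by simp [ENNReal.mul_eq_top])).trans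
      (eLpNorm_indicator_hat_le_of_le_abs z (by positivity) fun ξ hξ => by simpa using hξ)
  refine tendsto_of_tendsto_of_tendsto_of_le_of_le tendsto_const_nhds ?_ (fun _ => zero_le) h1
  have h2 : Tendsto (fun n : ℕ => ((2 : ℝ) ^ n) ^ (-(1 / 2) : ℝ)) atTop (𝓝 0) :=
    (tendsto_rpow_neg_atTop (by norm_num)).comp (tendsto_pow_atTop_atTop_of_one_lt (by norm_num))
  simpa using ENNReal.Tendsto.mul_const (ENNReal.tendsto_ofReal h2) (Or.inr enorm_ne_top)

/-- `L²` convergence of the truncations yields an a.e. convergent subsequence, and Fatou carries the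
uniform `L^q` bound to the limit. Membership of `z` in `L^q` is thus obtained rather than assumed.
-/
theorem eLpNorm_sub_lowPass_pow_le (z : sobolevHalf) (hq : 2 ≤ q) (hq_top : q ≠ ∞)
    {r : ℝ} (hr : r = 2 ^ (-(1 / q.toReal))) (hr1 : r < 1) (n : ℕ) :
    eLpNorm (⇑(toL2 z) - lowPass z (2 ^ n)) q ≤ ENNReal.ofReal (2 * r ^ n / (1 - r)) * ‖z‖ₑ := by
  have hc := fun k : ℕ => (continuous_lowPass z (2 ^ k)).aestronglyMeasurable (μ := volume)
  obtain ⟨ns, hns, hae⟩ := (tendstoInMeasure_of_tendsto_eLpNorm two_ne_zero hc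
    (Lp.aestronglyMeasurable (toL2 z)) (tendsto_eLpNorm_lowPass_sub z)).exists_seq_tendsto_ae
  have hr0 : 0 < r := hr ▸ by positivity
  refine Lp.eLpNorm_le_of_ae_tendsto (u := atTop)
    (f := fun i => lowPass z (2 ^ ns i) - lowPass z (2 ^ n)) ?_ (fun i => (hc _).sub (hc _)) ?_
  · filter_upwards [eventually_ge_atTop n] with i hi
    refine (eLpNorm_lowPass_pow_sub_le z hq hq_top hr hr1 (hi.trans (hns.id_le i))).trans ?_
    have : 0 < 1 - r := by linarith
    gcongr
    have := pow_pos hr0 (ns i)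
    linarith
  · filter_upwards [hae] with x hx
    exact hx.sub_const _

theorem eLpNorm_lowPass_le (z : sobolevHalf) (hq : 2 ≤ q) (hq_top : q ≠ ∞) (R : ℝ) :
    eLpNorm (lowPass z R) q
      ≤ ENNReal.ofReal (2 * R) ^ (1 / 2 - 1 / q.toReal : ℝ) * ‖z‖ₑ := by
  refine (eLpNorm_bandPart_le hq hq_top measurableSet_ball (by simp [ENNReal.mul_eq_top])
    (memLp_hat z)).trans ?_
  rw [Real.volume_ball, mul_comm]
  gcongr
  exact (eLpNorm_indicator_hat_le z) _

end

end sobolevHalf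

/-! ### Finite sums and finite-rank operators -/

theorem Lp_coeFn_finset_sum {α ι E : Type*} [MeasurableSpace α] [NormedAddCommGroup E]
    {μ : Measure α} {p : ℝ≥0∞} (s : Finset ι) (f : ι → Lp E p μ) :
    ⇑(∑ i ∈ s, f i) =ᵐ[μ] fun x => ∑ i ∈ s, f i x := by
  classical
  induction s using Finset.induction_on with
  | empty => rw [Finset.sum_empty]; exact Lp.coeFn_zero E p μ
  | insert i s hi ih =>
    rw [Finset.sum_insert hi]
    filter_upwards [ih, Lp.coeFn_add (f i) (∑ i ∈ s, f i)] with x h1 h2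
    rw [h2, Pi.add_apply, h1, Finset.sum_insert hi]

theorem isCompactOperator_sum {ι E F : Type*} [NormedAddCommGroup E] [NormedSpace ℝ E]
    [NormedAddCommGroup F] [NormedSpace ℝ F] (s : Finset ι) (f : ι → E →L[ℝ] F)
    (hf : ∀ i ∈ s, IsCompactOperator (f i)) : IsCompactOperator ⇑(∑ i ∈ s, f i) := by
  classical
  induction s using Finset.induction_on with
  | empty => simpa using isCompactOperator_zero
  | insert i s hi ih =>
    rw [Finset.sum_insert hi]
    exact (hf i (Finset.mem_insert_self i s)).add
      (ih fun j hj => hf j (Finset.mem_insert_of_mem hj))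

theorem isCompactOperator_smulRight {E F : Type*} [NormedAddCommGroup E] [NormedSpace ℝ E]
    [NormedAddCommGroup F] [NormedSpace ℝ F] (l : E →L[ℝ] ℝ) (v : F) :
    IsCompactOperator ⇑(l.smulRight v) :=
  (isCompactOperator_of_locallyCompactSpace_rng (ContinuousLinearMap.toSpanSingleton ℝ v)).comp_clm
    l

/-! ### Comparing the weighted measure with Lebesgue measure -/

section weighted

variable {W : ℝ → ℝ} {q : ℝ≥0∞}

theorem weightedMeasure_restrict_le {s : Set ℝ} (hs : MeasurableSet s) {c : ℝ}
    (hW : ∀ x ∈ s, W x ≤ c) :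
    (weightedMeasure W).restrict s ≤ ENNReal.ofReal c • volume.restrict s := by
  rw [weightedMeasure, restrict_withDensity hs, ← withDensity_const]
  refine withDensity_mono ?_
  filter_upwards [ae_restrict_mem hs] with x hx
  exact ENNReal.ofReal_le_ofReal (hW x hx)

theorem eLpNorm_weightedMeasure_restrict_le (hq_top : q ≠ ∞) {s : Set ℝ} (hs : MeasurableSet s)
    {c : ℝ} (hW : ∀ x ∈ s, W x ≤ c) (f : ℝ → ℝ) :
    eLpNorm f q ((weightedMeasure W).restrict s)
      ≤ ENNReal.ofReal c ^ (1 / q).toReal * eLpNorm f q (volume.restrict s) := by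
  refine (eLpNorm_mono_measure f (weightedMeasure_restrict_le hs hW)).trans_eq ?_
  rw [eLpNorm_smul_measure_of_ne_top hq_top, smul_eq_mul]

theorem eLpNorm_weightedMeasure_le (hq_top : q ≠ ∞) {c : ℝ} (hW : ∀ x, W x ≤ c) (f : ℝ → ℝ) :
    eLpNorm f q (weightedMeasure W) ≤ ENNReal.ofReal c ^ (1 / q).toReal * eLpNorm f q := by
  simpa using eLpNorm_weightedMeasure_restrict_le hq_top MeasurableSet.univ (fun x _ => hW x) f

theorem weightedMeasure_absolutelyContinuous : weightedMeasure W ≪ volume :=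
  withDensity_absolutelyContinuous _ _

theorem weightedMeasure_Ico_ne_top {c : ℝ} (hW : ∀ x, W x ≤ c) (a b : ℝ) :
    weightedMeasure W (Set.Ico a b) ≠ ∞ := by
  have h := weightedMeasure_restrict_le (W := W) MeasurableSet.univ (fun x _ => hW x) (Set.Ico a b)
  rw [Measure.restrict_univ, Measure.restrict_univ, Measure.smul_apply, Real.volume_Ico,
    smul_eq_mul] at h
  exact ne_top_of_le_ne_top (ENNReal.mul_ne_top ENNReal.ofReal_ne_top ENNReal.ofReal_ne_top) h

theorem exists_forall_le_of_tendsto_cocompact (hW : Continuous W)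
    (hlim : Tendsto W (cocompact ℝ) (𝓝 0)) : ∃ c, ∀ x, W x ≤ c := by
  -- A continuous function vanishing at infinity is bounded.
  let F : ZeroAtInftyContinuousMap ℝ ℝ := ⟨⟨W, hW⟩, hlim⟩
  exact ⟨‖F.toBCF‖, fun x => (le_abs_self _).trans (F.toBCF.norm_coe_le_norm x)⟩

end weighted

/-! ### The embedding and its approximation by sampling -/

namespace sobolevHalf

theorem hat_add (z w : sobolevHalf) : hat (z + w) =ᵐ[volume] hat z + hat w := by
  have h : hat (z + w) = ⇑(realFourier (toL2 z) + realFourier (toL2 w)) := by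
    rw [← realFourier_add]; rfl
  rw [h]
  exact Lp.coeFn_add _ _

theorem hat_smul (c : ℝ) (z : sobolevHalf) : hat (c • z) =ᵐ[volume] (c : ℂ) • hat z := by
  have h : hat (c • z) = ⇑((c : ℂ) • realFourier (toL2 z)) := by
    rw [← realFourier_smul]; rfl
  rw [h]
  exact Lp.coeFn_smul _ _

theorem enorm_lowPass_le (z : sobolevHalf) (R x : ℝ) :
    ‖lowPass z R x‖ₑ ≤ ENNReal.ofReal (2 * R) ^ (1 / 2 : ℝ) * ‖z‖ₑ := by
  refine (enorm_bandPart_le_rpow_mul measurableSet_ball (memLp_hat z) x).trans ?_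
  rw [Real.volume_ball, mul_comm]
  gcongr
  exact eLpNorm_indicator_hat_le z _

/-- Evaluation at `x` of the part of frequency less than `R`. -/
noncomputable def lowPassEval (R x : ℝ) : sobolevHalf →L[ℝ] ℝ :=
  LinearMap.mkContinuous
    { toFun := fun z => lowPass z R x
      map_add' := fun z w => by
        rw [lowPass, bandPart_congr_ae (hat_add z w)]
        exact bandPart_add measurableSet_ball (by simp [ENNReal.mul_eq_top]) (memLp_hat z)
          (memLp_hat w) x
      map_smul' := fun c z => by
        rw [lowPass, bandPart_congr_ae (hat_smul c z)]
        exact bandPart_smul c x }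
    (ENNReal.ofReal (2 * R) ^ (1 / 2 : ℝ)).toReal
    (fun z => by
      have h := ENNReal.toReal_mono (ENNReal.mul_ne_top
        (ENNReal.rpow_ne_top_of_nonneg (by norm_num) ENNReal.ofReal_ne_top) enorm_ne_top)
        (enorm_lowPass_le z R x)
      rwa [ENNReal.toReal_mul, toReal_enorm, toReal_enorm] at h)

theorem lowPassEval_apply (R x : ℝ) (z : sobolevHalf) : lowPassEval R x z = lowPass z R x := rfl

theorem enorm_lowPass_sub_le (z : sobolevHalf) {R : ℝ} (hR : 0 ≤ R) {x y δ : ℝ}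
    (hxy : |x - y| ≤ δ) :
    ‖lowPass z R x - lowPass z R y‖ₑ ≤ ENNReal.ofReal δ *
      (ENNReal.ofReal (2 * Real.pi * R) * ENNReal.ofReal (2 * R) ^ (1 / 2 : ℝ)) * ‖z‖ₑ := by
  have hb : eLpNorm ((Metric.ball (0 : ℝ) R).indicator (hat z)) 1
      ≤ ENNReal.ofReal (2 * R) ^ (1 / 2 : ℝ) * ‖z‖ₑ := by
    refine (eLpNorm_indicator_one_le measurableSet_ball (memLp_hat z)).trans ?_
    rw [Real.volume_ball, mul_comm]
    gcongr
    exact eLpNorm_indicator_hat_le z _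
  refine (enorm_bandPart_sub_le (R := R) measurableSet_ball (fun ξ hξ => ?_)
    (by simp [ENNReal.mul_eq_top]) (memLp_hat z) x y).trans ?_
  · exact (by simpa using hξ : |ξ| < R).le
  · calc _ ≤ ENNReal.ofReal (2 * Real.pi * R * δ)
          * (ENNReal.ofReal (2 * R) ^ (1 / 2 : ℝ) * ‖z‖ₑ) := by gcongr
      _ = _ := by
        rw [ENNReal.ofReal_mul (by positivity)]
        ring

section embedding

variable {W : ℝ → ℝ} {q : ℝ≥0∞}

theorem memLp_of_eLpNorm_le {C : ℝ≥0∞} (hC : C ≠ ∞)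
    (h : ∀ z : sobolevHalf, eLpNorm (toL2 z) q (weightedMeasure W) ≤ C * ‖z‖ₑ) (z : sobolevHalf) :
    MemLp (toL2 z) q (weightedMeasure W) :=
  ⟨(Lp.aestronglyMeasurable (toL2 z)).mono_ac weightedMeasure_absolutelyContinuous,
    (h z).trans_lt (ENNReal.mul_lt_top hC.lt_top enorm_lt_top)⟩

variable [Fact (1 ≤ q)]

theorem exists_eLpNorm_toL2_le (hq : 2 ≤ q) (hq_top : q ≠ ∞) {c : ℝ} (hW : ∀ x, W x ≤ c) :
    ∃ C : ℝ≥0∞, C ≠ ∞ ∧ ∀ z : sobolevHalf, eLpNorm (toL2 z) q (weightedMeasure W) ≤ C * ‖z‖ₑ := by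
  have hq2 : 2 ≤ q.toReal := by simpa using ENNReal.toReal_mono hq_top hq
  have hs : 0 ≤ 1 / 2 - 1 / q.toReal := by
    rw [sub_nonneg]; exact one_div_le_one_div_of_le (by norm_num) hq2
  have hr1 : (2 : ℝ) ^ (-(1 / q.toReal)) < 1 :=
    Real.rpow_lt_one_of_one_lt_of_neg (by norm_num) (neg_lt_zero.2 (by positivity))
  -- The constant comes from splitting at frequency `2^0 = 1`: the shell series bounds the high
  -- part, Bernstein on the ball the low part.
  refine ⟨ENNReal.ofReal c ^ (1 / q).toReal *
    (ENNReal.ofReal (2 * (2 ^ (-(1 / q.toReal))) ^ 0 / (1 - 2 ^ (-(1 / q.toReal))))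
      + ENNReal.ofReal (2 * 2 ^ 0) ^ (1 / 2 - 1 / q.toReal)), ?_, fun z => ?_⟩
  · exact ENNReal.mul_ne_top
      (ENNReal.rpow_ne_top_of_nonneg ENNReal.toReal_nonneg ENNReal.ofReal_ne_top)
      (ENNReal.add_ne_top.2 ⟨ENNReal.ofReal_ne_top,
        ENNReal.rpow_ne_top_of_nonneg hs ENNReal.ofReal_ne_top⟩)
  · refine (eLpNorm_weightedMeasure_le hq_top hW _).trans ?_
    rw [mul_assoc]
    refine mul_le_mul_right ?_ _
    have hc := (continuous_lowPass z (2 ^ 0)).aestronglyMeasurable (μ := volume)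
    rw [← sub_add_cancel ⇑(toL2 z) (lowPass z (2 ^ 0)), add_mul]
    exact (eLpNorm_add_le ((Lp.aestronglyMeasurable _).sub hc) hc Fact.out).trans
      (add_le_add (eLpNorm_sub_lowPass_pow_le z hq hq_top rfl hr1 0)
        (eLpNorm_lowPass_le z hq hq_top _))

/-- The natural map from `H^{1/2}` to a weighted space into which it embeds. -/
noncomputable def embedding {C : ℝ≥0∞} (hC : C ≠ ∞)
    (h : ∀ z : sobolevHalf, eLpNorm (toL2 z) q (weightedMeasure W) ≤ C * ‖z‖ₑ) :
    sobolevHalf →L[ℝ] WeightedLp q W :=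
  LinearMap.mkContinuous
    { toFun := fun z => (memLp_of_eLpNorm_le hC h z).toLp _
      map_add' := fun z w => by
        rw [← MemLp.toLp_add]
        exact MemLp.toLp_congr _ _ (weightedMeasure_absolutelyContinuous.ae_eq (Lp.coeFn_add _ _))
      map_smul' := fun c z => by
        rw [RingHom.id_apply, ← MemLp.toLp_const_smul]
        exact MemLp.toLp_congr _ _ (weightedMeasure_absolutelyContinuous.ae_eq
          (Lp.coeFn_smul c (toL2 z))) }
    C.toReal
    (fun z => by
      have h1 := ENNReal.toReal_mono (ENNReal.mul_ne_top hC enorm_ne_top) (h z)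
      rw [ENNReal.toReal_mul, toReal_enorm] at h1
      exact (Lp.norm_toLp _ (memLp_of_eLpNorm_le hC h z)).trans_le h1)

theorem embedding_ae_eq {C : ℝ≥0∞} (hC : C ≠ ∞)
    (h : ∀ z : sobolevHalf, eLpNorm (toL2 z) q (weightedMeasure W) ≤ C * ‖z‖ₑ) (z : sobolevHalf) :
    ⇑(embedding hC h z) =ᵐ[weightedMeasure W] toL2 z :=
  MemLp.coeFn_toLp (memLp_of_eLpNorm_le hC h z)

/-- Sampling the part of frequency less than `R` at the points `j * δ`, `-J ≤ j < J`. -/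
noncomputable def sampling (q : ℝ≥0∞) [Fact (1 ≤ q)] {c : ℝ}
    (hW : ∀ x, W x ≤ c) (R δ : ℝ)
    (J : ℕ) : sobolevHalf →L[ℝ] WeightedLp q W :=
  ∑ j ∈ Finset.Ico (-J : ℤ) J, (lowPassEval R (j * δ)).smulRight
    (indicatorConstLp q (measurableSet_Ico (a := j * δ) (b := (j + 1) * δ))
      (weightedMeasure_Ico_ne_top hW _ _) (1 : ℝ))

theorem isCompactOperator_sampling {c : ℝ} (hW : ∀ x, W x ≤ c) (R δ : ℝ) (J : ℕ) :
    IsCompactOperator ⇑(sampling q hW R δ J) :=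
  isCompactOperator_sum _ _ fun _ _ => isCompactOperator_smulRight _ _

/-- The half-open cells are disjoint and `x` lies in the one of index `⌊x / δ⌋`, so at most one
summand survives. -/
theorem sampling_ae_eq {c : ℝ} (hW : ∀ x, W x ≤ c) (R : ℝ) {δ : ℝ} (hδ : 0 < δ) (J : ℕ)
    (z : sobolevHalf) :
    ⇑(sampling q hW R δ J z) =ᵐ[weightedMeasure W]
      (Set.Ico (-(J * δ)) (J * δ)).indicator fun x => lowPass z R (⌊x / δ⌋ * δ) := by
  rw [sampling, sum_apply]
  have h1 : ∀ j : ℤ, ∀ᵐ x ∂weightedMeasure W,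
      ((lowPassEval R (j * δ)).smulRight
        (indicatorConstLp q (measurableSet_Ico (a := j * δ) (b := (j + 1) * δ))
          (weightedMeasure_Ico_ne_top hW _ _) (1 : ℝ)) z : WeightedLp q W) x
        = if j = ⌊x / δ⌋ then lowPass z R (j * δ) else 0 := fun j => by
    rw [ContinuousLinearMap.smulRight_apply]
    filter_upwards [Lp.coeFn_smul (lowPassEval R (j * δ) z) (indicatorConstLp q
      (measurableSet_Ico (a := j * δ) (b := (j + 1) * δ))
          (weightedMeasure_Ico_ne_top hW _ _) (1 : ℝ)), indicatorConstLp_coeFn (p := q)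
      (hs := measurableSet_Ico (a := j * δ) (b := (j + 1) * δ))
      (hμs := weightedMeasure_Ico_ne_top hW _ _) (c := (1 : ℝ))] with x h2 h3
    rw [h2, Pi.smul_apply, h3, lowPassEval_apply]
    have hiff : x ∈ Set.Ico (j * δ) ((j + 1) * δ) ↔ j = ⌊x / δ⌋ := by
      rw [eq_comm, Int.floor_eq_iff, le_div_iff₀ hδ, div_lt_iff₀ hδ]; rfl
    by_cases h : j = ⌊x / δ⌋
    · rw [Set.indicator_of_mem (hiff.2 h), if_pos h, smul_eq_mul, mul_one]
    · rw [Set.indicator_of_notMem (fun hx => h (hiff.1 hx)), if_neg h, smul_zero]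
  filter_upwards [Lp_coeFn_finset_sum (Finset.Ico (-J : ℤ) J) (fun j : ℤ =>
    (lowPassEval R (j * δ)).smulRight
        (indicatorConstLp q (measurableSet_Ico (a := j * δ) (b := (j + 1) * δ))
          (weightedMeasure_Ico_ne_top hW _ _) (1 : ℝ)) z), ae_all_iff.2 h1] with x h2 h3
  rw [h2]
  simp only [h3]
  rw [Finset.sum_ite_eq']
  have hiff : ⌊x / δ⌋ ∈ Finset.Ico (-J : ℤ) J ↔ x ∈ Set.Ico (-(J * δ)) (J * δ) := by
    rw [Finset.mem_Ico, Int.le_floor, Int.floor_lt, le_div_iff₀ hδ, div_lt_iff₀ hδ]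
    push_cast
    rw [neg_mul]
    rfl
  by_cases h : ⌊x / δ⌋ ∈ Finset.Ico (-J : ℤ) J
  · rw [if_pos h, Set.indicator_of_mem (hiff.1 h)]
  · rw [if_neg h, Set.indicator_of_notMem (fun hx => h (hiff.2 hx))]

/-- The three terms are the frequencies above `2^n`, the truncation outside the window, where the
weight is at most `e`, and the discretization error inside it. -/
theorem eLpNorm_toL2_sub_sampling_le (hq : 2 ≤ q) (hq_top : q ≠ ∞) {c e : ℝ}
    (hW : ∀ x, W x ≤ c) {r : ℝ} (hr : r = 2 ^ (-(1 / q.toReal))) (hr1 : r < 1) (n : ℕ) {δ : ℝ}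
    (hδ : 0 < δ) (J : ℕ) (he : ∀ x ∉ Set.Ico (-(J * δ)) (J * δ), W x ≤ e) (z : sobolevHalf) :
    eLpNorm (⇑(toL2 z) - ⇑(sampling q hW (2 ^ n) δ J z)) q (weightedMeasure W)
      ≤ (ENNReal.ofReal c ^ (1 / q).toReal * ENNReal.ofReal (2 * r ^ n / (1 - r))
        + (ENNReal.ofReal e ^ (1 / q).toReal
            * ENNReal.ofReal (2 * 2 ^ n) ^ (1 / 2 - 1 / q.toReal : ℝ)
          + ENNReal.ofReal c ^ (1 / q).toReal * (ENNReal.ofReal δ *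
            (ENNReal.ofReal (2 * Real.pi * 2 ^ n) * ENNReal.ofReal (2 * 2 ^ n) ^ (1 / 2 : ℝ))
            * ENNReal.ofReal (2 * (J * δ)) ^ q.toReal⁻¹))) * ‖z‖ₑ := by
  generalize hK : Set.Ico (-(J * δ)) (J * δ) = K at he
  have hKm : MeasurableSet K := hK ▸ measurableSet_Ico
  set v := lowPass z (2 ^ n) with hv
  set s : ℝ → ℝ := fun x => v (⌊x / δ⌋ * δ) with hs
  have hq1 : 1 ≤ q := Fact.out
  have hvc : Continuous v := continuous_lowPass z _
  have hsm : Measurable s := hvc.measurable.comp (by fun_prop)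
  have hum : AEStronglyMeasurable (toL2 z) (weightedMeasure W) :=
    (Lp.aestronglyMeasurable (toL2 z)).mono_ac weightedMeasure_absolutelyContinuous
  have hdec : ⇑(toL2 z) - ⇑(sampling q hW (2 ^ n) δ J z) =ᵐ[weightedMeasure W]
      (⇑(toL2 z) - v) + (Kᶜ.indicator v + K.indicator (v - s)) := by
    filter_upwards [sampling_ae_eq (q := q) hW (2 ^ n) hδ J z] with x hx
    simp only [Pi.sub_apply, Pi.add_apply, hx]
    rw [hK]
    by_cases h : x ∈ K
    · simp [-Set.mem_Ico, hs, hv, h]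
    · simp [-Set.mem_Ico, h]
  have h1 : eLpNorm (⇑(toL2 z) - v) q (weightedMeasure W)
      ≤ ENNReal.ofReal c ^ (1 / q).toReal * ENNReal.ofReal (2 * r ^ n / (1 - r)) * ‖z‖ₑ := by
    refine (eLpNorm_weightedMeasure_le hq_top hW _).trans ?_
    rw [mul_assoc]
    exact mul_le_mul_right (eLpNorm_sub_lowPass_pow_le z hq hq_top hr hr1 n) _
  have h2 : eLpNorm (Kᶜ.indicator v) q (weightedMeasure W) ≤ ENNReal.ofReal e ^ (1 / q).toReal
            * ENNReal.ofReal (2 * 2 ^ n) ^ (1 / 2 - 1 / q.toReal : ℝ) * ‖z‖ₑ := by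
    rw [eLpNorm_indicator_eq_eLpNorm_restrict hKm.compl, mul_assoc]
    refine (eLpNorm_weightedMeasure_restrict_le hq_top hKm.compl he v).trans ?_
    exact mul_le_mul_right ((eLpNorm_restrict_le _ _ _ _).trans
      (eLpNorm_lowPass_le z hq hq_top _)) _
  have h3 : eLpNorm (K.indicator (v - s)) q (weightedMeasure W)
      ≤ ENNReal.ofReal c ^ (1 / q).toReal * (ENNReal.ofReal δ *
            (ENNReal.ofReal (2 * Real.pi * 2 ^ n) * ENNReal.ofReal (2 * 2 ^ n) ^ (1 / 2 : ℝ))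
            * ENNReal.ofReal (2 * (J * δ)) ^ q.toReal⁻¹) * ‖z‖ₑ := by
    rw [eLpNorm_indicator_eq_eLpNorm_restrict hKm, mul_assoc]
    refine (eLpNorm_weightedMeasure_restrict_le hq_top hKm (fun x _ => hW x) _).trans ?_
    refine mul_le_mul_right ?_ _
    -- Each point is within `δ` of its grid point, so the Lipschitz bound is uniform; the window's
    -- length enters to the power `1/q`.
    refine (eLpNorm_le_of_ae_enorm_bound (.of_forall fun x =>
      enorm_lowPass_sub_le z (by positivity) (δ := δ) ?_)).trans_eq ?_
    · rw [abs_le]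
      have h4 := (le_div_iff₀ hδ).1 (Int.floor_le (x / δ))
      have h5 := (div_lt_iff₀ hδ).1 (Int.lt_floor_add_one (x / δ))
      constructor <;> linarith
    · rw [Measure.restrict_apply_univ, ← hK, Real.volume_Ico, smul_eq_mul,
        show J * δ - -(J * δ) = 2 * (J * δ) by ring]
      ring
  rw [eLpNorm_congr_ae hdec]
  have hvm := hvc.aestronglyMeasurable (μ := weightedMeasure W)
  refine (eLpNorm_add_le (hum.sub hvm) ((hvm.indicator hKm.compl).add
    ((hvm.sub hsm.aestronglyMeasurable).indicator hKm)) hq1).trans ?_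
  rw [add_mul, add_mul]
  exact add_le_add h1 ((eLpNorm_add_le (hvm.indicator hKm.compl)
    ((hvm.sub hsm.aestronglyMeasurable).indicator hKm) hq1).trans (add_le_add h2 h3))

end embedding

end sobolevHalf

/-! ### Compactness of the embedding -/

/-- An operator that compact operators approximate in norm is compact. -/
theorem isCompactOperator_of_forall_exists_norm_sub_lt {E F : Type*} [NormedAddCommGroup E]
    [NormedSpace ℝ E] [NormedAddCommGroup F] [NormedSpace ℝ F] [CompleteSpace F] {T : E →L[ℝ] F}
    (h : ∀ ε > 0, ∃ S : E →L[ℝ] F, IsCompactOperator ⇑S ∧ ‖T - S‖ < ε) : IsCompactOperator ⇑T := by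
  have hclosed : IsClosed {f : E →L[ℝ] F | IsCompactOperator ⇑f} :=
    isClosed_setOfPred_isCompactOperator
  have hT : T ∈ closure {f : E →L[ℝ] F | IsCompactOperator ⇑f} :=
    (Metric.mem_closure_iff (α := E →L[ℝ] F)).2 fun ε hε => by
      simpa [dist_eq_norm] using h ε hε
  exact hclosed.closure_subset hT

theorem compactlyEmbedded_of_tendsto_cocompact {W : ℝ → ℝ} (hWc : Continuous W)
    (hlim : Tendsto W (cocompact ℝ) (𝓝 0)) (q : ℝ≥0∞) [Fact (1 ≤ q)] (hq : 2 ≤ q)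
    (hq_top : q ≠ ∞) : CompactlyEmbedded q W := by
  obtain ⟨c, hc⟩ := exists_forall_le_of_tendsto_cocompact hWc hlim
  obtain ⟨C, hC, hbound⟩ := sobolevHalf.exists_eLpNorm_toL2_le hq hq_top hc
  refine ⟨sobolevHalf.embedding hC hbound, sobolevHalf.embedding_ae_eq hC hbound, ?_⟩
  set T := sobolevHalf.embedding hC hbound
  have hq2 : 2 ≤ q.toReal := by simpa using ENNReal.toReal_mono hq_top hq
  have hs : 0 ≤ 1 / 2 - 1 / q.toReal := by
    rw [sub_nonneg]; exact one_div_le_one_div_of_le (by norm_num) hq2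
  have hq' : 0 < (1 / q).toReal := by
    rw [ENNReal.toReal_div]; simp only [ENNReal.toReal_one]; positivity
  obtain ⟨r, hr⟩ : ∃ r : ℝ, r = 2 ^ (-(1 / q.toReal)) := ⟨_, rfl⟩
  have hr0 : 0 < r := hr ▸ by positivity
  have hr1 : r < 1 :=
    hr ▸ Real.rpow_lt_one_of_one_lt_of_neg (by norm_num) (neg_lt_zero.2 (by positivity))
  have hcq : ENNReal.ofReal c ^ (1 / q).toReal ≠ ∞ :=
    ENNReal.rpow_ne_top_of_nonneg hq'.le ENNReal.ofReal_ne_top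
  refine isCompactOperator_of_forall_exists_norm_sub_lt fun ε hε => ?_
  have hη : (0 : ℝ≥0∞) < ENNReal.ofReal (ε / 4) := ENNReal.ofReal_pos.2 (by positivity)
  obtain ⟨n, hn⟩ : ∃ n : ℕ, ENNReal.ofReal c ^ (1 / q).toReal
      * ENNReal.ofReal (2 * r ^ n / (1 - r)) ≤ ENNReal.ofReal (ε / 4) := by
    have h1 : Tendsto (fun n : ℕ => 2 * r ^ n / (1 - r)) atTop (𝓝 0) := by
      simpa using ((tendsto_pow_atTop_nhds_zero_of_lt_one hr0.le hr1).const_mul 2).div_const (1 - r)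
    have h2 := ENNReal.Tendsto.const_mul (ENNReal.tendsto_ofReal h1) (Or.inr hcq)
    rw [ENNReal.ofReal_zero, mul_zero] at h2
    exact (h2.eventually_le_const hη).exists
  have hA : ENNReal.ofReal (2 * 2 ^ n) ^ (1 / 2 - 1 / q.toReal) ≠ ∞ :=
    ENNReal.rpow_ne_top_of_nonneg hs ENNReal.ofReal_ne_top
  -- The level `e` is chosen after `n`, because the bound on the truncation's `L^q` norm depends on
  -- `n`.
  obtain ⟨e, he0, he⟩ : ∃ e : ℝ, 0 < e ∧ ENNReal.ofReal e ^ (1 / q).toReal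
      * ENNReal.ofReal (2 * 2 ^ n) ^ (1 / 2 - 1 / q.toReal) ≤ ENNReal.ofReal (ε / 4) := by
    have h1 : Tendsto (fun e : ℝ => ENNReal.ofReal e ^ (1 / q).toReal) (𝓝[>] 0) (𝓝 0) := by
      have := ((ENNReal.continuous_rpow_const (y := (1 / q).toReal)).comp
        ENNReal.continuous_ofReal).tendsto 0
      simp only [Function.comp_def, ENNReal.ofReal_zero, ENNReal.zero_rpow_of_pos hq'] at this
      exact this.mono_left nhdsWithin_le_nhds
    have h2 := ENNReal.Tendsto.mul_const h1 (Or.inr hA)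
    rw [zero_mul] at h2
    obtain ⟨e, h3, h4⟩ := ((h2.eventually_le_const hη).and self_mem_nhdsWithin).exists
    exact ⟨e, h4, h3⟩
  obtain ⟨M, hM0, hM⟩ : ∃ M : ℝ, 0 < M ∧ ∀ x ∉ Set.Ico (-M) M, W x ≤ e := by
    have h1 := hlim.eventually_le_const he0
    rw [Metric.cobounded_eq_cocompact.symm] at h1
    obtain ⟨M, hM⟩ := (Metric.hasBasis_cobounded_compl_closedBall (0 : ℝ)).eventually_iff.1 h1
    -- The added `1` gives positivity and keeps the open right endpoint of the window outside the
    -- closed ball.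
    refine ⟨max M 0 + 1, by positivity, fun x hx => hM.2 ?_⟩
    rw [Set.mem_compl_iff, Metric.mem_closedBall, dist_zero_right, Real.norm_eq_abs, abs_le]
    rintro ⟨h2, h3⟩
    have := le_max_left M 0
    exact hx ⟨by linarith, by linarith⟩
  -- With mesh `M / J`, the window stays `[-M, M)` while the grid is refined.
  obtain ⟨J, hJ0, hJ⟩ : ∃ J : ℕ, 0 < J ∧ ENNReal.ofReal c ^ (1 / q).toReal
      * (ENNReal.ofReal (M / J) *
            (ENNReal.ofReal (2 * Real.pi * 2 ^ n) * ENNReal.ofReal (2 * 2 ^ n) ^ (1 / 2 : ℝ))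
            * ENNReal.ofReal (2 * M) ^ q.toReal⁻¹) ≤ ENNReal.ofReal (ε / 4) := by
    have h2 := ENNReal.Tendsto.const_mul (ENNReal.Tendsto.mul_const (ENNReal.Tendsto.mul_const
      (ENNReal.tendsto_ofReal (tendsto_const_div_atTop_nhds_zero_nat M))
      (Or.inr (ENNReal.mul_ne_top (ENNReal.ofReal_ne_top (r := 2 * Real.pi * 2 ^ n))
        (ENNReal.rpow_ne_top_of_nonneg (y := (1 / 2 : ℝ)) (by norm_num)
          (ENNReal.ofReal_ne_top (r := 2 * 2 ^ n))))))
      (Or.inr (ENNReal.rpow_ne_top_of_nonneg (y := q.toReal⁻¹) (by positivity)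
          (ENNReal.ofReal_ne_top (r := 2 * M))))) (Or.inr hcq)
    simp only [ENNReal.ofReal_zero, zero_mul, mul_zero] at h2
    obtain ⟨J, h3, h4⟩ := ((h2.eventually_le_const hη).and (eventually_gt_atTop 0)).exists
    exact ⟨J, h4, h3⟩
  have hJM : J * (M / J) = M := by field_simp
  refine ⟨sobolevHalf.sampling q hc (2 ^ n) (M / J) J,
    sobolevHalf.isCompactOperator_sampling hc _ _ _, ?_⟩
  -- Three errors of `ε / 4` leave room for the strict inequality.
  refine (ContinuousLinearMap.opNorm_le_bound _ (M := 3 * (ε / 4)) (by positivity)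
    fun z => ?_).trans_lt (by linarith)
  have hz := sobolevHalf.eLpNorm_toL2_sub_sampling_le (q := q) hq hq_top hc hr hr1 n
    (δ := M / J) (by positivity) J (by rwa [hJM]) z
  rw [hJM] at hz
  have hz2 := hz.trans (mul_le_mul_left (add_le_add hn (add_le_add he hJ)) _)
  have heq : ‖(T - sobolevHalf.sampling q hc (2 ^ n) (M / J) J) z‖ₑ
      = eLpNorm (⇑(sobolevHalf.toL2 z) - ⇑(sobolevHalf.sampling q hc (2 ^ n) (M / J) J z)) q
        (weightedMeasure W) := by
    rw [sub_apply, Lp.enorm_def]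
    refine eLpNorm_congr_ae ?_
    filter_upwards [Lp.coeFn_sub (T z) (sobolevHalf.sampling q hc (2 ^ n) (M / J) J z),
      sobolevHalf.embedding_ae_eq hC hbound z] with x h1 h2
    rw [h1, Pi.sub_apply, Pi.sub_apply, h2]
  rw [← heq, ← ENNReal.ofReal_add (by positivity) (by positivity),
    ← ENNReal.ofReal_add (by positivity) (by positivity), ← ofReal_norm, ← ofReal_norm,
    ← ENNReal.ofReal_mul (by positivity), ENNReal.ofReal_le_ofReal_iff (by positivity)] at hz2
  linarith

theorem lemma2p1 (P Q : ℝ → ℝ)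
    (hP : Continuous P) (hQ : Continuous Q)
    (hP_nonneg : ∀ x, 0 ≤ P x) (hQ_nonneg : ∀ x, 0 ≤ Q x)
    (hP_lim : Tendsto P (cocompact ℝ) (𝓝 0)) (hQ_lim : Tendsto Q (cocompact ℝ) (𝓝 0))
    (q : ℝ≥0∞) [Fact (1 ≤ q)] (hq_two : 2 ≤ q) (hq_top : q ≠ ∞) :
    CompactlyEmbedded q P ∧ CompactlyEmbedded q Q :=
  ⟨compactlyEmbedded_of_tendsto_cocompact hP hP_lim q hq_two hq_top,
    compactlyEmbedded_of_tendsto_cocompact hQ hQ_lim q hq_two hq_top⟩
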